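/- Let $n\ge 1$, let $T=\{t_1<t_2<\dots<t_r\}\subseteq\{1,\dots,n-1\}$ with $r\ge 1$, and assume $t_r\le n/2$. A flag of $[n]=\{1,\dots,n\}$ is a set $f$ of non-empty proper subsets of $[n]$ any two of which are comparable under inclusion; its type is $\{|A| : A\in f\}$. Let $\mathcal F^T_n$ be the set of flags of type $T$, and let $\Gamma(n,T)$ be the graph with vertex set $\mathcal F^T_n$ in which $f,g$ are adjacent if and only if $A\cap B=\emptyset$ or $A\cup B=[n]$ for all $A\in f$, $B\in g$. For a $t_r$-subset $A$ of $[n]$ put $\mathcal F^{(T|A)}_n=\{f\in\mathcal F^T_n : A\in f\}$, let $m=|\mathcal F^{(T|A)}_n|$ (for any such $A$), and let $\Sigma=\{\mathcal F^{(T|A)}_n : A\subseteq[n],\ |A|=t_r\}$. Let $KG(n,t_r)$ be the graph whose vertices are the $t_r$-subsets of $[n]$, two being adjacent when they are disjoint. 1. $\mathrm{Aut}(\Gamma(n,T))$ acts transitively on $\mathcal F^T_n$, and $\Sigma$ is a system of blocks for this action, i.e. $\Sigma$ is the set of all translates of one non-empty block. If $r\ge 2$, then every block in $\Sigma$ is nontrivial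 (it has at least two elements and is not all of $\mathcal F^T_n$). 2. $\mathrm{Aut}(\Gamma(n,T))\cong (S_m)^{\binom{n}{t_r}}\rtimes \mathrm{Aut}(KG(n,t_r))$. 3. If $t_r<n/2$, or if $n=2$, then $\mathrm{Aut}(\Gamma(n,T))\cong (S_m)^{\binom{n}{t_r}}\rtimes S_n$. In both semidirect products the factors of $(S_m)^{\binom{n}{t_r}}$ are indexed by the $t_r$-subsets of $[n]$, and the right-hand group permutes these factors through its natural action on the $t_r$-subsets. -/

import Mathlib

/-- A flag of `[n]`: a set of non-empty proper subsets of `[n]`, any two of which are comparable. -/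
def IsFlag {n : ℕ} (f : Finset (Finset (Fin n))) : Prop :=
  (∀ A ∈ f, A.Nonempty ∧ A ≠ Finset.univ) ∧ ∀ A ∈ f, ∀ B ∈ f, A ⊆ B ∨ B ⊆ A

/-- The type of a flag: the set of the sizes of its members. -/
def flagType {n : ℕ} (f : Finset (Finset (Fin n))) : Finset ℕ :=
  f.image Finset.card

/-- The flags of `[n]` of type `T`. -/
abbrev FlagOfType (n : ℕ) (T : Finset ℕ) : Type :=
  {f : Finset (Finset (Fin n)) // IsFlag f ∧ flagType f = T}

/-- Two families are in general position with respect to `[n]`. -/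
def InGeneralPosition {n : ℕ} (f g : Finset (Finset (Fin n))) : Prop :=
  ∀ A ∈ f, ∀ B ∈ g, A ∩ B = ∅ ∨ A ∪ B = Finset.univ

/-- The general position graph `Γ(n,T)`. For non-empty `T` no flag is in general position with
itself, so the clause `f ≠ g` matters only for `T = ∅`. -/
def generalPositionGraph (n : ℕ) (T : Finset ℕ) : SimpleGraph (FlagOfType n T) where
  Adj f g := f ≠ g ∧ InGeneralPosition f.1 g.1
  symm := ⟨fun f g h => ⟨h.1.symm, fun A hA B hB => by
    simpa only [Finset.inter_comm, Finset.union_comm] using h.2 B hB A hA⟩⟩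
  loopless := ⟨fun _ h => h.1 rfl⟩

/-- The flags of type `T` that contain the subset `A`. -/
def flagsThrough {n : ℕ} (T : Finset ℕ) (A : Finset (Fin n)) : Set (FlagOfType n T) :=
  {f | A ∈ f.1}

/-- The Kneser graph: the vertices are the `k`-subsets of `[n]`, adjacent when disjoint.
The clause `A ≠ B` matters only for `k = 0`. -/
def kneserGraph (n k : ℕ) : SimpleGraph (Set.powersetCard (Fin n) k) where
  Adj A B := A ≠ B ∧ Disjoint (A : Finset (Fin n)) (B : Finset (Fin n))
  symm := ⟨fun _ _ h => ⟨h.1.symm, h.2.symm⟩⟩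
  loopless := ⟨fun _ h => h.1 rfl⟩

/-- The full automorphism group of a graph. -/
abbrev GraphAut {V : Type} (Γ : SimpleGraph V) : Type := Γ ≃g Γ

/-- `S` is a system of blocks for `G` acting on `X`: the action is transitive and `S` is the set
of all translates of one non-empty block. -/
def IsSystemOfBlocks (G : Type) {X : Type} [Group G] [MulAction G X] (S : Set (Set X)) : Prop :=
  MulAction.IsPretransitive G X ∧
    ∃ D : Set X, D.Nonempty ∧ MulAction.IsBlock G D ∧ S = {E | ∃ g : G, E = (g • ·) '' D}

/-- The permutational wreath product `(S_m)^Ω ⋊ G`, in which `G` permutes the factors of the direct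
power through its action on the index set `Ω`: `(g • u) ω = u (g⁻¹ • ω)`. -/
abbrev PermWreath (m : ℕ) (Ω G : Type) [Group G] [MulAction G Ω] : Type :=
  (Ω → Equiv.Perm (Fin m)) ⋊[(mulAutArrow : G →* MulAut (Ω → Equiv.Perm (Fin m)))] G

/-! All sizes are at most `n / 2`, so two top members whose union is `[n]` are already disjoint, and
the smaller members lie inside the tops. Hence flags are adjacent exactly when their tops are, in
the Kneser graph: Γ is a blow-up of it, each vertex replaced by `m` independent flags
(`generalPositionGraph_adj`).

For `2 * t ≤ n` the Kneser graph has no twins, so two flags have the same neighbours exactly when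
they share a top. Automorphisms of Γ therefore permute the fibres and induce automorphisms of the
base. Coordinates on the fibres turn this into a wreath product (`nonempty_mulEquiv_permWreath`),
for any faithful group that realises all automorphisms of the base.

For `2 * t < n` that group can be `S_n`. Counting common neighbours recovers the Johnson graph.
There a star (all sets one element larger than a fixed centre) is a clique too large for the other
kind, the subsets of one larger set; so the map descends to the centres, and induction on the set
size ends at singletons (`exists_perm_of_johnson`). -/

/-! ### Automorphisms of blow-ups of twin-free graphs. -/

section BlowUp

variable {V Ω : Type} {Γ : SimpleGraph V} {K : SimpleGraph Ω}

/-- Automorphisms of a blow-up of a twin-free graph preserve the fibres. -/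
lemma fibre_eq_iff_of_blowUp {π : V → Ω} (hπ : Function.Surjective π)
    (hΓ : ∀ f g, Γ.Adj f g ↔ K.Adj (π f) (π g))
    (hK : ∀ a b, (∀ c, K.Adj a c ↔ K.Adj b c) → a = b) (φ : GraphAut Γ) (f g : V) :
    π (φ f) = π (φ g) ↔ π f = π g := by
  have key : ∀ (ψ : GraphAut Γ) (f g : V), π f = π g → π (ψ f) = π (ψ g) := by
    intro ψ f g h
    refine hK _ _ fun c => ?_
    obtain ⟨d, rfl⟩ := hπ c
    obtain ⟨d, rfl⟩ := ψ.surjective d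
    rw [← hΓ, ← hΓ, ψ.map_adj_iff, ψ.map_adj_iff, hΓ, hΓ, h]
  refine ⟨fun h => ?_, key φ f g⟩
  simpa using key φ.symm _ _ h

variable {G : Type} [Group G] [MulAction G Ω] {m : ℕ}

/-- The permutation of `V` that an element of the wreath product induces through an identification
of `V` with `Ω × Fin m`. -/
def wreathPerm (e : V ≃ Ω × Fin m) (w : PermWreath m Ω G) : Equiv.Perm V :=
  e.permCongr.symm
    -- Reading `w.left` at the target fibre is what matches composition with the semidirect product
    -- law for `(g • u) ω = u (g⁻¹ • ω)`.
    { toFun := fun p => (w.right • p.1, w.left (w.right • p.1) p.2)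
      invFun := fun p => (w.right⁻¹ • p.1, (w.left p.1).symm p.2)
      left_inv := fun p => by simp
      right_inv := fun p => by simp }

lemma apply_wreathPerm (e : V ≃ Ω × Fin m) (w : PermWreath m Ω G) (f : V) :
    e (wreathPerm e w f) = (w.right • (e f).1, w.left (w.right • (e f).1) (e f).2) := by
  simp [wreathPerm]

/-- The action of the wreath product on a blow-up, as a homomorphism to its automorphism group. -/
def wreathHom (e : V ≃ Ω × Fin m) (hΓ : ∀ f g, Γ.Adj f g ↔ K.Adj (e f).1 (e g).1)
    (hadj : ∀ (g : G) (a b : Ω), K.Adj (g • a) (g • b) ↔ K.Adj a b) :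
    PermWreath m Ω G →* GraphAut Γ where
  toFun w := ⟨wreathPerm e w, fun {f g} => by
    rw [hΓ, apply_wreathPerm, apply_wreathPerm, hadj, hΓ]⟩
  map_one' := by
    ext f
    apply e.injective
    change e (wreathPerm e 1 f) = e f
    rw [apply_wreathPerm]
    simp
  map_mul' w z := by
    ext f
    apply e.injective
    change e (wreathPerm e (w * z) f) = e (wreathPerm e w (wreathPerm e z f))
    rw [apply_wreathPerm, apply_wreathPerm, apply_wreathPerm]
    refine Prod.ext (mul_smul _ _ _) ?_
    change w.left _ (z.left (w.right⁻¹ • (w.right * z.right) • (e f).1) (e f).2) = _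
    simp [mul_smul]

lemma apply_wreathHom (e : V ≃ Ω × Fin m) (hΓ : ∀ f g, Γ.Adj f g ↔ K.Adj (e f).1 (e g).1)
    (hadj : ∀ (g : G) (a b : Ω), K.Adj (g • a) (g • b) ↔ K.Adj a b)
    (w : PermWreath m Ω G) (f : V) :
    e (wreathHom e hΓ hadj w f) = (w.right • (e f).1, w.left (w.right • (e f).1) (e f).2) :=
  apply_wreathPerm e w f

/-- Non-empty fibres make the base action visible on `V`, so faithfulness kills the `G` part; what
remains acts on each fibre separately. -/
lemma wreathHom_injective [FaithfulSMul G Ω] [NeZero m] (e : V ≃ Ω × Fin m)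
    (hΓ : ∀ f g, Γ.Adj f g ↔ K.Adj (e f).1 (e g).1)
    (hadj : ∀ (g : G) (a b : Ω), K.Adj (g • a) (g • b) ↔ K.Adj a b) :
    Function.Injective (wreathHom e hΓ hadj) := by
  rw [injective_iff_map_eq_one]
  intro w hw
  have h : ∀ p : Ω × Fin m, (w.right • p.1, w.left (w.right • p.1) p.2) = p := by
    intro p
    have := apply_wreathHom e hΓ hadj w (e.symm p)
    rw [hw] at this
    simpa using this.symm
  have hr : w.right = 1 := by
    refine FaithfulSMul.eq_of_smul_eq_smul (α := Ω) fun a => ?_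
    simpa using congrArg Prod.fst (h (a, 0))
  refine SemidirectProduct.ext ?_ hr
  funext a
  ext1 i
  have := congrArg Prod.snd (h (a, i))
  rw [hr] at this
  simpa using this

/-- Twin-freeness lets `φ` descend to an automorphism `κ` of `K`, which some `g` realises; the fibre
coordinates of `φ` then supply the permutations `u`. -/
lemma wreathHom_surjective [NeZero m] (e : V ≃ Ω × Fin m)
    (hΓ : ∀ f g, Γ.Adj f g ↔ K.Adj (e f).1 (e g).1)
    (hK : ∀ a b, (∀ c, K.Adj a c ↔ K.Adj b c) → a = b)
    (hadj : ∀ (g : G) (a b : Ω), K.Adj (g • a) (g • b) ↔ K.Adj a b)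
    (hG : ∀ φ : GraphAut K, ∃ g : G, ∀ a, φ a = g • a) :
    Function.Surjective (wreathHom e hΓ hadj) := by
  intro φ
  have hπ : Function.Surjective fun f => (e f).1 := fun a => ⟨e.symm (a, 0), by simp⟩
  have hfib := fibre_eq_iff_of_blowUp (π := fun f => (e f).1) hπ hΓ hK
  have hind : ∀ (ψ : GraphAut Γ) (a : Ω) (f : V), (e f).1 = a →
      (e (ψ f)).1 = (e (ψ (e.symm (a, 0)))).1 := fun ψ a f hf => (hfib ψ _ _).2 (by simpa)
  -- The point `0` is an arbitrary representative of its fibre; `hind` gives independence of this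
  -- choice.
  let κ : GraphAut K :=
    { toFun := fun a => (e (φ (e.symm (a, 0)))).1
      invFun := fun a => (e (φ.symm (e.symm (a, 0)))).1
      left_inv := fun a => by
        dsimp only
        rw [← hind φ.symm _ _ rfl]
        simp
      right_inv := fun a => by
        dsimp only
        rw [← hind φ _ _ rfl]
        simp
      map_rel_iff' := fun {a b} => by
        rw [Equiv.coe_fn_mk, ← hΓ, φ.map_adj_iff, hΓ]
        simp }
  obtain ⟨g, hg⟩ := hG κ
  have hφ : ∀ a i, (e (φ (e.symm (a, i)))).1 = g • a := fun a i => by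
    rw [← hg a]
    exact hind φ a _ (by simp)
  have hφ' : ∀ a i, (e (φ.symm (e.symm (g • a, i)))).1 = a := fun a i => by
    apply MulAction.injective g
    change g • _ = g • a
    rw [← hφ _ (e (φ.symm (e.symm (g • a, i)))).2]
    simp
  let u : Ω → Equiv.Perm (Fin m) := fun b =>
    { toFun := fun i => (e (φ (e.symm (g⁻¹ • b, i)))).2
      invFun := fun i => (e (φ.symm (e.symm (b, i)))).2
      left_inv := fun i => by
        have : e.symm (b, (e (φ (e.symm (g⁻¹ • b, i)))).2) = φ (e.symm (g⁻¹ • b, i)) := by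
          rw [Equiv.symm_apply_eq]
          exact Prod.ext (by rw [hφ, smul_inv_smul]) rfl
        simp [this]
      right_inv := fun i => by
        have : e.symm (g⁻¹ • b, (e (φ.symm (e.symm (b, i)))).2) = φ.symm (e.symm (b, i)) := by
          rw [Equiv.symm_apply_eq]
          refine Prod.ext ?_ rfl
          have := hφ' (g⁻¹ • b) i
          rw [smul_inv_smul] at this
          exact this.symm
        simp [this] }
  refine ⟨⟨u, g⟩, ?_⟩
  ext f
  apply e.injective
  rw [apply_wreathHom]
  refine Prod.ext ?_ ?_
  · simpa using (hφ (e f).1 (e f).2).symm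
  · simp [u]

/-- The automorphism group of a blow-up of a twin-free graph is a wreath product. -/
lemma nonempty_mulEquiv_permWreath [FaithfulSMul G Ω] [NeZero m] (e : V ≃ Ω × Fin m)
    (hΓ : ∀ f g, Γ.Adj f g ↔ K.Adj (e f).1 (e g).1)
    (hK : ∀ a b, (∀ c, K.Adj a c ↔ K.Adj b c) → a = b)
    (hadj : ∀ (g : G) (a b : Ω), K.Adj (g • a) (g • b) ↔ K.Adj a b)
    (hG : ∀ φ : GraphAut K, ∃ g : G, ∀ a, φ a = g • a) :
    Nonempty (GraphAut Γ ≃* PermWreath m Ω G) :=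
  ⟨(MulEquiv.ofBijective (wreathHom e hΓ hadj)
    ⟨wreathHom_injective e hΓ hadj, wreathHom_surjective e hΓ hK hadj hG⟩).symm⟩

/-- A blow-up of a graph is vertex-transitive if some group of automorphisms of the graph is. -/
lemma isPretransitive_blowUp [MulAction.IsPretransitive G Ω] (e : V ≃ Ω × Fin m)
    (hΓ : ∀ f g, Γ.Adj f g ↔ K.Adj (e f).1 (e g).1)
    (hadj : ∀ (g : G) (a b : Ω), K.Adj (g • a) (g • b) ↔ K.Adj a b) :
    MulAction.IsPretransitive (GraphAut Γ) V := by
  refine ⟨fun f f' => ?_⟩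
  obtain ⟨g, hg⟩ := MulAction.exists_smul_eq G (e f).1 (e f').1
  -- Here `g` moves the fibre, and the swap corrects the position inside it.
  refine ⟨wreathHom e hΓ hadj ⟨fun _ => Equiv.swap (e f).2 (e f').2, g⟩, e.injective ?_⟩
  change e (wreathHom e hΓ hadj _ f) = _
  rw [apply_wreathHom]
  exact Prod.ext hg (by simp)

/-- The fibres of a vertex-transitive blow-up of a twin-free graph form a system of blocks. -/
lemma isSystemOfBlocks_fibres [MulAction.IsPretransitive (GraphAut Γ) V] [Nonempty V] {π : V → Ω}
    (hπ : Function.Surjective π) (hΓ : ∀ f g, Γ.Adj f g ↔ K.Adj (π f) (π g))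
    (hK : ∀ a b, (∀ c, K.Adj a c ↔ K.Adj b c) → a = b) :
    IsSystemOfBlocks (GraphAut Γ) {D : Set V | ∃ a, D = π ⁻¹' {a}} := by
  have hfib := fibre_eq_iff_of_blowUp hπ hΓ hK
  obtain ⟨f₀⟩ := ‹Nonempty V›
  have himg : ∀ φ : GraphAut Γ, (φ • ·) '' (π ⁻¹' {π f₀}) = π ⁻¹' {π (φ f₀)} := by
    intro φ
    ext f
    constructor
    · rintro ⟨g, hg, rfl⟩
      exact (hfib φ g f₀).2 hg
    · intro hf
      refine ⟨φ.symm f, ?_, φ.apply_symm_apply f⟩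
      apply (hfib φ _ _).1
      rwa [φ.apply_symm_apply]
  refine ⟨inferInstance, π ⁻¹' {π f₀}, ⟨f₀, rfl⟩, fun φ ψ h => ?_, ?_⟩
  · change (φ • ·) '' (π ⁻¹' {π f₀}) ≠ (ψ • ·) '' (π ⁻¹' {π f₀}) at h
    change Disjoint ((φ • ·) '' (π ⁻¹' {π f₀})) ((ψ • ·) '' (π ⁻¹' {π f₀}))
    rw [himg, himg] at h ⊢
    exact Disjoint.preimage π (by simpa using fun h' => h (by rw [h']))
  · ext D
    constructor
    · rintro ⟨a, rfl⟩
      obtain ⟨f, rfl⟩ := hπ a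
      obtain ⟨φ, hφ⟩ := MulAction.exists_smul_eq (GraphAut Γ) f₀ f
      refine ⟨φ, ?_⟩
      rw [himg, ← hφ]
      rfl
    · rintro ⟨φ, rfl⟩
      exact ⟨_, himg φ⟩

end BlowUp

/-! ### Cliques and rigidity of the Johnson graph. -/

section Johnson

open scoped Pointwise

variable {α : Type*} [DecidableEq α]

/-- If `s ∈ A ∩ B` is missing from `C`, it is the only element of `A` or of `B` that is missing; so
`C` contains `(A ∪ B).erase s`, and equals it by size. -/
lemma inter_subset_or_subset_union_of_card {k : ℕ} {A B C : Finset α} (hA : A.card = k + 1)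
    (hB : B.card = k + 1) (hC : C.card = k + 1) (hAB : (A ∪ B).card = k + 2)
    (hAC : (A ∪ C).card = k + 2) (hBC : (B ∪ C).card = k + 2) :
    A ∩ B ⊆ C ∨ C ⊆ A ∪ B := by
  by_contra! h
  obtain ⟨⟨s, hs, hsC⟩, h2⟩ := (⟨Finset.not_subset.1 h.1, h.2⟩ : _ ∧ _)
  rw [Finset.mem_inter] at hs
  have sub : ∀ D : Finset α, s ∈ D → D.card = k + 1 → (D ∪ C).card = k + 2 → D.erase s ⊆ C := by
    intro D hsD hD hDC
    have h1 : (D \ C).card = 1 := by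
      have := Finset.card_sdiff_add_card D C
      omega
    obtain ⟨x, hx⟩ := Finset.card_eq_one.1 h1
    have hsx : s ∈ D \ C := Finset.mem_sdiff.2 ⟨hsD, hsC⟩
    intro y hy
    by_contra hyC
    have hyx : y ∈ D \ C := Finset.mem_sdiff.2 ⟨Finset.mem_of_mem_erase hy, hyC⟩
    rw [hx, Finset.mem_singleton] at hsx hyx
    exact Finset.ne_of_mem_erase hy (hyx.trans hsx.symm)
  have hsub : (A ∪ B).erase s ⊆ C := by
    intro y hy
    rw [Finset.mem_erase, Finset.mem_union] at hy
    rcases hy.2 with h | h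
    · exact sub A hs.1 hA hAC (Finset.mem_erase.2 ⟨hy.1, h⟩)
    · exact sub B hs.2 hB hBC (Finset.mem_erase.2 ⟨hy.1, h⟩)
  have heq := Finset.eq_of_subset_of_card_le hsub (by
    rw [Finset.card_erase_of_mem (Finset.mem_union_left _ hs.1)]; omega)
  exact h2 (heq ▸ Finset.erase_subset _ _)

/-- A large clique of the Johnson graph is contained in a star. -/
lemma exists_center_of_clique {k : ℕ} {K : Finset (Finset α)} (hK : ∀ A ∈ K, A.card = k + 1)
    (hadj : ∀ A ∈ K, ∀ B ∈ K, A ≠ B → (A ∪ B).card = k + 2) (hcard : k + 3 ≤ K.card) :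
    ∃ S : Finset α, S.card = k ∧ ∀ A ∈ K, S ⊆ A := by
  obtain ⟨A, hA, B, hB, hAB⟩ := Finset.one_lt_card.1 (show 1 < K.card by omega)
  -- A `(k+2)`-set has only `k + 2` subsets of size `k + 1`, so some `C` in the clique leaves `A ∪
  -- B`.
  have hnot : ¬ K ⊆ (A ∪ B).powersetCard (k + 1) := fun h => by
    have := Finset.card_le_card h
    rw [Finset.card_powersetCard, hadj A hA B hB hAB, Nat.choose_succ_self_right] at this
    omega
  obtain ⟨C, hC, hCn⟩ := Finset.not_subset.1 hnot
  have hCAB : ¬ C ⊆ A ∪ B := fun h => hCn (Finset.mem_powersetCard.2 ⟨h, hK C hC⟩)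
  have hAC : A ≠ C := by rintro rfl; exact hCAB Finset.subset_union_left
  have hBC : B ≠ C := by rintro rfl; exact hCAB Finset.subset_union_right
  have inter_card : ∀ D ∈ K, ∀ E ∈ K, D ≠ E → (D ∩ E).card = k := fun D hD E hE hDE => by
    have := Finset.card_union_add_card_inter D E
    rw [hadj D hD E hE hDE, hK D hD, hK E hE] at this
    omega
  have hSC : A ∩ B ⊆ C := (inter_subset_or_subset_union_of_card (hK A hA) (hK B hB) (hK C hC)
    (hadj A hA B hB hAB) (hadj A hA C hC hAC) (hadj B hB C hC hBC)).resolve_right hCAB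
  have hACS : A ∩ B = A ∩ C := Finset.eq_of_subset_of_card_le
    (Finset.subset_inter Finset.inter_subset_left hSC)
    (by rw [inter_card A hA B hB hAB, inter_card A hA C hC hAC])
  have hBCS : A ∩ B = B ∩ C := Finset.eq_of_subset_of_card_le
    (Finset.subset_inter Finset.inter_subset_right hSC)
    (by rw [inter_card A hA B hB hAB, inter_card B hB C hC hBC])
  refine ⟨A ∩ B, inter_card A hA B hB hAB, fun D hD => ?_⟩
  by_contra hSD
  have hDA : A ≠ D := by rintro rfl; exact hSD Finset.inter_subset_left
  have hDB : B ≠ D := by rintro rfl; exact hSD Finset.inter_subset_right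
  have hDC : C ≠ D := by rintro rfl; exact hSD hSC
  -- If `D` misses part of the centre, it lies in both `A ∪ B` and `A ∪ C`; as `B ∩ C = A ∩ B`, this
  -- forces `D ⊆ A`.
  have h1 := (inter_subset_or_subset_union_of_card (hK A hA) (hK B hB) (hK D hD)
    (hadj A hA B hB hAB) (hadj A hA D hD hDA) (hadj B hB D hD hDB)).resolve_left hSD
  have h2 := (inter_subset_or_subset_union_of_card (hK A hA) (hK C hC) (hK D hD)
    (hadj A hA C hC hAC) (hadj A hA D hD hDA) (hadj C hC D hD hDC)).resolve_left (hACS ▸ hSD)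
  have h3 : D ⊆ A := by
    intro x hx
    by_contra hxA
    have hxB := (Finset.mem_union.1 (h1 hx)).resolve_left hxA
    have hxC := (Finset.mem_union.1 (h2 hx)).resolve_left hxA
    have : x ∈ A ∩ B := hBCS ▸ Finset.mem_inter.2 ⟨hxB, hxC⟩
    exact hxA (Finset.mem_inter.1 this).1
  exact hDA (Finset.eq_of_subset_of_card_le h3 (by rw [hK A hA, hK D hD])).symm

variable [Fintype α]

/-- The sets that arise from `S` by adding one element. -/
def starOf (S : Finset α) : Finset (Finset α) := Sᶜ.image (insert · S)

lemma mem_starOf {S A : Finset α} : A ∈ starOf S ↔ S ⊆ A ∧ A.card = S.card + 1 := by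
  simp only [starOf, Finset.mem_image, Finset.mem_compl]
  constructor
  · rintro ⟨a, ha, rfl⟩
    exact ⟨Finset.subset_insert _ _, Finset.card_insert_of_notMem ha⟩
  · rintro ⟨hSA, hcard⟩
    have h1 : (A \ S).card = 1 := by rw [Finset.card_sdiff_of_subset hSA]; omega
    obtain ⟨a, ha⟩ := Finset.card_eq_one.1 h1
    refine ⟨a, (Finset.mem_sdiff.1 (ha ▸ Finset.mem_singleton_self a : a ∈ A \ S)).2, ?_⟩
    rw [← Finset.sdiff_union_of_subset hSA, ha]
    rfl

lemma card_starOf (S : Finset α) : (starOf S).card = Fintype.card α - S.card := by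
  rw [starOf, Finset.card_image_of_injOn, Finset.card_compl]
  intro a ha b _ hab
  have : a ∈ insert b S := by
    rw [← show insert a S = insert b S from hab]
    exact Finset.mem_insert_self a S
  rcases Finset.mem_insert.1 this with h | h
  · exact h
  · exact absurd h (Finset.mem_compl.1 ha)

lemma card_union_of_mem_starOf {S A B : Finset α} (hA : A ∈ starOf S) (hB : B ∈ starOf S)
    (hAB : A ≠ B) : (A ∪ B).card = S.card + 2 := by
  simp only [starOf, Finset.mem_image, Finset.mem_compl] at hA hB
  obtain ⟨a, ha, rfl⟩ := hA
  obtain ⟨b, hb, rfl⟩ := hB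
  have hab : a ≠ b := by rintro rfl; exact hAB rfl
  have : insert a S ∪ insert b S = insert a (insert b S) := by
    ext x; simp only [Finset.mem_union, Finset.mem_insert]; tauto
  rw [this, Finset.card_insert_of_notMem (by simp [hab, ha]), Finset.card_insert_of_notMem hb]

/-- The centre is the intersection of any two distinct members of the star; the size bound provides
two. -/
lemma starOf_injective_of_card {S S' : Finset α} (hS : S.card + 2 ≤ Fintype.card α)
    (hcard : S'.card = S.card) (h : starOf S = starOf S') : S = S' := by
  obtain ⟨A, hA, B, hB, hAB⟩ := Finset.one_lt_card.1
    (show 1 < (starOf S).card by rw [card_starOf]; omega)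
  have hU := card_union_of_mem_starOf hA hB hAB
  have hI := Finset.card_union_add_card_inter A B
  have hA' := mem_starOf.1 (h ▸ hA)
  have hB' := mem_starOf.1 (h ▸ hB)
  rw [mem_starOf] at hA hB
  have h1 := Finset.eq_of_subset_of_card_le (Finset.subset_inter hA.1 hB.1) (by omega)
  have h2 := Finset.eq_of_subset_of_card_le (Finset.subset_inter hA'.1 hB'.1) (by omega)
  rw [h1, h2]

/-- Maps that preserve adjacency in the Johnson graph send stars to stars. -/
lemma exists_image_starOf_eq {k : ℕ} (hk : 2 * (k + 1) < Fintype.card α)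
    (φ : Finset α → Finset α) (hcard : ∀ A, A.card = k + 1 → (φ A).card = k + 1)
    (hinj : ∀ A B, A.card = k + 1 → B.card = k + 1 → φ A = φ B → A = B)
    (hadj : ∀ A B, A.card = k + 1 → B.card = k + 1 → (A ∪ B).card = k + 2 →
      (φ A ∪ φ B).card = k + 2) {S : Finset α} (hS : S.card = k) :
    ∃ S' : Finset α, S'.card = k ∧ (starOf S).image φ = starOf S' := by
  have hmem : ∀ A ∈ starOf S, A.card = k + 1 := fun A hA => by
    rw [(mem_starOf.1 hA).2, hS]
  have himg : ((starOf S).image φ).card = Fintype.card α - k := by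
    rw [Finset.card_image_of_injOn, card_starOf, hS]
    exact fun A hA B hB hAB => hinj A B (hmem A hA) (hmem B hB) hAB
  have hK : ∀ A ∈ (starOf S).image φ, A.card = k + 1 := by
    intro A hA
    obtain ⟨X, hX, rfl⟩ := Finset.mem_image.1 hA
    exact hcard X (hmem X hX)
  obtain ⟨S', hS', hsub⟩ := exists_center_of_clique hK
    (by
      intro A hA B hB hAB
      obtain ⟨X, hX, rfl⟩ := Finset.mem_image.1 hA
      obtain ⟨Y, hY, rfl⟩ := Finset.mem_image.1 hB
      refine hadj X Y (hmem X hX) (hmem Y hY) ?_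
      rw [card_union_of_mem_starOf hX hY (by rintro rfl; exact hAB rfl), hS])
    -- The star has `Fintype.card α - k` members; `2 * (k + 1) < Fintype.card α` says precisely that
    -- this is at least `k + 3`.
    (by omega)
  refine ⟨S', hS', Finset.eq_of_subset_of_card_le (fun A hA => ?_) ?_⟩
  · exact mem_starOf.2 ⟨hsub A hA, by rw [hK A hA, hS']⟩
  · rw [himg, card_starOf, hS']

/-- An injective map on the `(k+1)`-subsets of a set that preserves adjacency in the Johnson graph
is induced by a permutation of the underlying set. -/
theorem exists_perm_of_johnson (k : ℕ) (hk : 2 * (k + 1) < Fintype.card α ∨ k = 0)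
    (φ : Finset α → Finset α) (hcard : ∀ A, A.card = k + 1 → (φ A).card = k + 1)
    (hinj : ∀ A B, A.card = k + 1 → B.card = k + 1 → φ A = φ B → A = B)
    (hadj : ∀ A B, A.card = k + 1 → B.card = k + 1 → (A ∪ B).card = k + 2 →
      (φ A ∪ φ B).card = k + 2) :
    ∃ σ : Equiv.Perm α, ∀ A, A.card = k + 1 → φ A = σ • A := by
  induction k generalizing φ with
  | zero =>
    have h : ∀ a, ∃ b, φ {a} = {b} := fun a => Finset.card_eq_one.1 (hcard _ (by simp))
    choose f hf using h
    have hfi : Function.Injective f := fun a b hab => by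
      have := hinj {a} {b} (by simp) (by simp) (by rw [hf, hf, hab])
      simpa using this
    refine ⟨Equiv.ofBijective f (Finite.injective_iff_bijective.1 hfi), fun A hA => ?_⟩
    obtain ⟨a, rfl⟩ := Finset.card_eq_one.1 hA
    simp [hf]
  | succ k ih =>
    have hn : 2 * (k + 2) < Fintype.card α := by omega
    have hex : ∀ S : Finset α, ∃ S' : Finset α, S.card = k + 1 →
        S'.card = k + 1 ∧ (starOf S).image φ = starOf S' := by
      intro S
      by_cases hS : S.card = k + 1
      · obtain ⟨S', h1, h2⟩ := exists_image_starOf_eq (by omega) φ hcard hinj hadj hS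
        exact ⟨S', fun _ => ⟨h1, h2⟩⟩
      · exact ⟨∅, fun h => absurd h hS⟩
    -- `ψ` sends the centre of a star to the centre of the image star; on other sizes its values are
    -- irrelevant.
    choose ψ hψ using hex
    have hψsub : ∀ S A : Finset α, S.card = k + 1 → A.card = k + 2 → S ⊆ A → ψ S ⊆ φ A := by
      intro S A hS hA hSA
      have : φ A ∈ starOf (ψ S) := by
        rw [← (hψ S hS).2]
        exact Finset.mem_image_of_mem _ (mem_starOf.2 ⟨hSA, by omega⟩)
      exact (mem_starOf.1 this).1
    have hψinj : ∀ S S' : Finset α, S.card = k + 1 → S'.card = k + 1 → ψ S = ψ S' → S = S' := by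
      intro S S' hS hS' h
      refine starOf_injective_of_card (by omega) (by omega) ?_
      have himage : (starOf S).image φ = (starOf S').image φ := by
        rw [(hψ S hS).2, (hψ S' hS').2, h]
      have sub : ∀ R R' : Finset α, R.card = k + 1 → R'.card = k + 1 →
          (starOf R).image φ = (starOf R').image φ → starOf R ⊆ starOf R' := by
        intro R R' hR hR' hRR A hA
        obtain ⟨B, hB, hBA⟩ := Finset.mem_image.1 (hRR ▸ Finset.mem_image_of_mem φ hA)
        have h1 := (mem_starOf.1 hA).2
        have h2 := (mem_starOf.1 hB).2
        rwa [← hinj B A (by omega) (by omega) hBA]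
      exact (sub S S' hS hS' himage).antisymm (sub S' S hS' hS himage.symm)
    -- For adjacent `S`, `S'` both images lie in the `(k+2)`-set `φ (S ∪ S')`; being distinct, they
    -- fill it.
    obtain ⟨σ, hσ⟩ := ih (Or.inl (by omega)) ψ (fun S hS => (hψ S hS).1) hψinj (by
      intro S S' hS hS' hSS
      have hsub : ψ S ∪ ψ S' ⊆ φ (S ∪ S') := Finset.union_subset
        (hψsub S _ hS hSS Finset.subset_union_left) (hψsub S' _ hS' hSS Finset.subset_union_right)
      have hle := Finset.card_le_card hsub
      rw [hcard _ hSS] at hle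
      refine le_antisymm hle ?_
      by_contra hlt
      have c1 := (hψ S hS).1
      have c2 := (hψ S' hS').1
      have e1 := Finset.eq_of_subset_of_card_le (Finset.subset_union_left : ψ S ⊆ ψ S ∪ ψ S')
        (by omega)
      have e2 := Finset.eq_of_subset_of_card_le (Finset.subset_union_right : ψ S' ⊆ ψ S ∪ ψ S')
        (by omega)
      have := hψinj S S' hS hS' (e1.trans e2.symm)
      rw [this, Finset.union_self] at hSS
      omega)
    -- As `A` has at least two elements, it is the union of its subsets `A.erase b`, on which `σ`
    -- agrees with `ψ`.
    refine ⟨σ, fun A hA => (Finset.eq_of_subset_of_card_le ?_ ?_).symm⟩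
    · intro y hy
      obtain ⟨a, ha, rfl⟩ := Finset.mem_smul_finset.1 hy
      obtain ⟨b, hb, hab⟩ := Finset.exists_mem_ne (show 1 < A.card by omega) a
      have hS : (A.erase b).card = k + 1 := by rw [Finset.card_erase_of_mem hb]; omega
      apply hψsub _ A hS hA (Finset.erase_subset b A)
      rw [hσ _ hS]
      exact Finset.smul_mem_smul_finset (Finset.mem_erase.2 ⟨hab.symm, ha⟩)
    · rw [hcard A hA, Finset.card_smul_finset, hA]

end Johnson

/-! ### Twins, common neighbours and automorphisms of Kneser graphs. -/

section Kneser

open scoped Pointwise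

variable {n t : ℕ}

lemma kneserGraph_adj (ht : 0 < t) (A B : Set.powersetCard (Fin n) t) :
    (kneserGraph n t).Adj A B ↔ Disjoint (A : Finset (Fin n)) (B : Finset (Fin n)) := by
  refine ⟨fun h => h.2, fun h => ⟨?_, h⟩⟩
  rintro rfl
  have h1 : (A : Finset (Fin n)).card = t := A.2
  rw [disjoint_self.1 h] at h1
  simp at h1
  omega

lemma kneserGraph_adj_smul (ht : 0 < t) (σ : Equiv.Perm (Fin n)) (A B : Set.powersetCard (Fin n) t) :
    (kneserGraph n t).Adj (σ • A) (σ • B) ↔ (kneserGraph n t).Adj A B := by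
  rw [kneserGraph_adj ht, kneserGraph_adj ht, Set.powersetCard.coe_smul, Set.powersetCard.coe_smul,
    Finset.smul_finset_def, Finset.smul_finset_def,
    Finset.disjoint_image (MulAction.injective σ)]

/-- Kneser graphs of sets of size at most half have no twins. -/
lemma kneserGraph_twinFree (ht : 0 < t) (htn : 2 * t ≤ n) (A B : Set.powersetCard (Fin n) t)
    (h : ∀ C, (kneserGraph n t).Adj A C ↔ (kneserGraph n t).Adj B C) : A = B := by
  have hA : (A : Finset (Fin n)).card = t := A.2
  have hB : (B : Finset (Fin n)).card = t := B.2
  apply Subtype.ext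
  refine (Finset.eq_of_subset_of_card_le (fun b hb => ?_) (by rw [hA, hB])).symm
  by_contra hbA
  -- The complement of `A` has `n - t ≥ t` elements, enough for a neighbour of `A` through `b`,
  -- which is no neighbour of `B`.
  obtain ⟨C, hC1, hC2, hC3⟩ := Finset.exists_subsuperset_card_eq
    (Finset.singleton_subset_iff.2 (Finset.mem_compl.2 hbA)) (n := t) (by rw [Finset.card_singleton]; omega)
    (by rw [Finset.card_compl, hA, Fintype.card_fin]; omega)
  have h1 := (h ⟨C, hC3⟩).1 ((kneserGraph_adj ht _ _).2
    (Finset.disjoint_left.2 fun x hx hxC => Finset.mem_compl.1 (hC2 hxC) hx))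
  rw [kneserGraph_adj ht] at h1
  exact Finset.disjoint_left.1 h1 hb (Finset.singleton_subset_iff.1 hC1)

lemma ncard_commonNeighbors_kneserGraph (ht : 0 < t) (A B : Set.powersetCard (Fin n) t) :
    ((kneserGraph n t).commonNeighbors A B).ncard =
      (n - ((A : Finset (Fin n)) ∪ (B : Finset (Fin n))).card).choose t := by
  rw [← Set.ncard_image_of_injective _ Subtype.val_injective]
  have : Subtype.val '' ((kneserGraph n t).commonNeighbors A B) =
      (((A : Finset (Fin n)) ∪ (B : Finset (Fin n)))ᶜ.powersetCard t : Set (Finset (Fin n))) := by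
    ext C
    rw [Finset.mem_coe, Finset.mem_powersetCard]
    constructor
    · rintro ⟨C, hC, rfl⟩
      rw [SimpleGraph.mem_commonNeighbors, kneserGraph_adj ht, kneserGraph_adj ht,
        ← Finset.disjoint_union_left] at hC
      exact ⟨Finset.subset_compl_iff_disjoint_left.2 hC, C.2⟩
    · rintro ⟨h1, h2⟩
      refine ⟨⟨C, h2⟩, ?_, rfl⟩
      rw [SimpleGraph.mem_commonNeighbors, kneserGraph_adj ht, kneserGraph_adj ht,
        ← Finset.disjoint_union_left]
      exact Finset.subset_compl_iff_disjoint_left.1 h1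
  rw [this, Set.ncard_coe_finset, Finset.card_powersetCard, Finset.card_compl, Fintype.card_fin]

/-- Automorphisms of Kneser graphs preserve adjacency in the Johnson graph. -/
lemma card_union_of_kneserGraph_aut (ht : 0 < t) (htn : 2 * t < n) (φ : GraphAut (kneserGraph n t))
    {A B : Set.powersetCard (Fin n) t}
    (h : ((A : Finset (Fin n)) ∪ (B : Finset (Fin n))).card = t + 1) :
    ((φ A : Finset (Fin n)) ∪ (φ B : Finset (Fin n))).card = t + 1 := by
  have hcn : ((kneserGraph n t).commonNeighbors (φ A) (φ B)) =
      φ '' ((kneserGraph n t).commonNeighbors A B) := by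
    ext C
    obtain ⟨C, rfl⟩ := φ.surjective C
    rw [φ.injective.mem_set_image, SimpleGraph.mem_commonNeighbors, φ.map_adj_iff, φ.map_adj_iff,
      SimpleGraph.mem_commonNeighbors]
  have hcard := congrArg Set.ncard hcn
  rw [Set.ncard_image_of_injective _ φ.injective, ncard_commonNeighbors_kneserGraph ht,
    ncard_commonNeighbors_kneserGraph ht, h] at hcard
  have hA : (A : Finset (Fin n)).card = t := A.2
  have hA' : (φ A : Finset (Fin n)).card = t := (φ A).2
  have hB' : (φ B : Finset (Fin n)).card = t := (φ B).2
  have hge : t + 1 ≤ ((φ A : Finset (Fin n)) ∪ (φ B : Finset (Fin n))).card := by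
    by_contra hlt
    have e1 := Finset.eq_of_subset_of_card_le
      (Finset.subset_union_left (s₁ := (φ A : Finset (Fin n))) (s₂ := (φ B : Finset (Fin n))))
      (by omega)
    have e2 := Finset.eq_of_subset_of_card_le
      (Finset.subset_union_right (s₁ := (φ A : Finset (Fin n))) (s₂ := (φ B : Finset (Fin n))))
      (by omega)
    have := φ.injective (Subtype.ext (e1.trans e2.symm))
    rw [this, Finset.union_self, ← this, hA] at h
    omega
  by_contra hne
  -- A union larger than `t + 1` would have strictly fewer common neighbours: by Pascal's rule the
  -- count drops by at least `l.choose s`, positive because `2 * t < n`.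
  obtain ⟨s, rfl⟩ : ∃ s, t = s + 1 := ⟨t - 1, by omega⟩
  obtain ⟨l, hl⟩ : ∃ l, n - (s + 1 + 1) = l + 1 := ⟨n - (s + 1 + 1) - 1, by omega⟩
  have hle := Nat.choose_le_choose (s + 1)
    (show n - ((φ A : Finset (Fin n)) ∪ (φ B : Finset (Fin n))).card ≤ l by omega)
  have hpos := Nat.choose_pos (show s ≤ l by omega)
  rw [hl, Nat.choose_succ_succ'] at hcard
  omega

/-- The automorphisms of the Kneser graph are induced by permutations of the ground set. -/
theorem exists_perm_of_kneserGraph_aut (ht : 0 < t) (htn : 2 * t < n ∨ t = 1)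
    (φ : GraphAut (kneserGraph n t)) : ∃ σ : Equiv.Perm (Fin n), ∀ A, φ A = σ • A := by
  obtain ⟨k, rfl⟩ : ∃ k, t = k + 1 := ⟨t - 1, by omega⟩
  let ψ : Finset (Fin n) → Finset (Fin n) := fun A =>
    if h : A.card = k + 1 then (φ ⟨A, Set.powersetCard.mem_iff.2 h⟩ : Finset (Fin n)) else ∅
  have hψ : ∀ (A) (h : A.card = k + 1), ψ A = (φ ⟨A, Set.powersetCard.mem_iff.2 h⟩ : Finset (Fin n)) := fun A h => dif_pos h
  obtain ⟨σ, hσ⟩ := exists_perm_of_johnson k (by rw [Fintype.card_fin]; omega) ψ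
    (fun A hA => by rw [hψ A hA]; exact (φ ⟨A, hA⟩).2)
    (fun A B hA hB h => by
      rw [hψ A hA, hψ B hB] at h
      exact congrArg Subtype.val (φ.injective (Subtype.ext h)))
    (fun A B hA hB h => by
      rw [hψ A hA, hψ B hB]
      rcases htn with htn | htn
      · exact card_union_of_kneserGraph_aut ht htn φ (A := ⟨A, hA⟩) (B := ⟨B, hB⟩) h
      -- Any two distinct singletons are adjacent in the Johnson graph, so only injectivity is
      -- needed.
      · obtain rfl : k = 0 := by omega
        have hAB : φ ⟨A, hA⟩ ≠ φ ⟨B, hB⟩ := fun he => by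
          have : A = B := congrArg Subtype.val (φ.injective he)
          rw [this, Finset.union_self] at h
          omega
        obtain ⟨a, ha⟩ := Finset.card_eq_one.1 (φ ⟨A, hA⟩).2
        obtain ⟨b, hb⟩ := Finset.card_eq_one.1 (φ ⟨B, hB⟩).2
        have hab : a ≠ b := by
          rintro rfl
          exact hAB (Subtype.ext (ha.trans hb.symm))
        rw [ha, hb]
        exact Finset.card_pair hab)
  refine ⟨σ, fun A => Subtype.ext ?_⟩
  rw [Set.powersetCard.coe_smul, ← hσ _ A.2]
  exact (hψ A.1 A.2).symm

end Kneser

/-- A map from a finite type whose fibres all have `m` elements is a projection from a product. -/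
lemma exists_equiv_prod_of_ncard_fibre {V Ω : Type} [Finite V] {m : ℕ} {π : V → Ω}
    (h : ∀ a, (π ⁻¹' {a}).ncard = m) : ∃ e : V ≃ Ω × Fin m, ∀ f, (e f).1 = π f := by
  have hc : ∀ a, Nat.card {f // π f = a} = m := h
  refine ⟨(Equiv.sigmaFiberEquiv π).symm.trans
    ((Equiv.sigmaCongrRight fun a => Finite.equivFinOfCardEq (hc a)).trans
      (Equiv.sigmaEquivProd Ω (Fin m))), fun f => rfl⟩

/-! ### Flags and their largest members. -/

section Flags

open scoped Pointwise

variable {n : ℕ} {T : Finset ℕ} {t : ℕ}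

lemma FlagOfType.card_mem (f : FlagOfType n T) {A : Finset (Fin n)} (hA : A ∈ f.1) :
    A.card ∈ T := by
  rw [← f.2.2]
  exact Finset.mem_image_of_mem _ hA

lemma FlagOfType.eq_of_card_eq (f : FlagOfType n T) {A B : Finset (Fin n)} (hA : A ∈ f.1)
    (hB : B ∈ f.1) (h : A.card = B.card) : A = B := by
  rcases f.2.1.2 A hA B hB with hAB | hBA
  · exact Finset.eq_of_subset_of_card_le hAB h.ge
  · exact (Finset.eq_of_subset_of_card_le hBA h.le).symm

lemma FlagOfType.exists_mem_card (f : FlagOfType n T) {k : ℕ} (hk : k ∈ T) :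
    ∃ A ∈ f.1, A.card = k := by
  rw [← f.2.2] at hk
  exact Finset.mem_image.1 hk

/-- The largest member of a flag. -/
noncomputable def flagTop (ht : IsGreatest (T : Set ℕ) t) (f : FlagOfType n T) :
    Set.powersetCard (Fin n) t :=
  ⟨(f.exists_mem_card ht.1).choose,
    Set.powersetCard.mem_iff.2 (f.exists_mem_card ht.1).choose_spec.2⟩

lemma card_flagTop (ht : IsGreatest (T : Set ℕ) t) (f : FlagOfType n T) :
    (flagTop ht f : Finset (Fin n)).card = t :=
  (flagTop ht f).2

lemma flagTop_mem (ht : IsGreatest (T : Set ℕ) t) (f : FlagOfType n T) :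
    (flagTop ht f : Finset (Fin n)) ∈ f.1 :=
  (f.exists_mem_card ht.1).choose_spec.1

lemma flagTop_eq_iff (ht : IsGreatest (T : Set ℕ) t) (f : FlagOfType n T)
    (A : Set.powersetCard (Fin n) t) : flagTop ht f = A ↔ (A : Finset (Fin n)) ∈ f.1 := by
  constructor
  · rintro rfl
    exact flagTop_mem ht f
  · intro hA
    refine Subtype.ext (f.eq_of_card_eq (flagTop_mem ht f) hA ?_)
    rw [card_flagTop]
    exact A.2.symm

lemma preimage_flagTop (ht : IsGreatest (T : Set ℕ) t) (A : Set.powersetCard (Fin n) t) :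
    flagTop ht ⁻¹' {A} = flagsThrough T (A : Finset (Fin n)) := by
  ext f
  exact flagTop_eq_iff ht f A

lemma subset_flagTop (ht : IsGreatest (T : Set ℕ) t) (f : FlagOfType n T) {A : Finset (Fin n)}
    (hA : A ∈ f.1) : A ⊆ (flagTop ht f : Finset (Fin n)) := by
  rcases f.2.1.2 A hA _ (flagTop_mem ht f) with h | h
  · exact h
  · refine (Finset.eq_of_subset_of_card_le h ?_).ge
    rw [card_flagTop]
    exact ht.2 (f.card_mem hA)

/-- When all sizes are at most `n / 2`, two flags are in general position if and only if their
largest members are disjoint. -/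
lemma inGeneralPosition_iff (ht : IsGreatest (T : Set ℕ) t) (htn : 2 * t ≤ n)
    (f g : FlagOfType n T) : InGeneralPosition f.1 g.1 ↔
      Disjoint (flagTop ht f : Finset (Fin n)) (flagTop ht g : Finset (Fin n)) := by
  constructor
  · intro h
    rw [Finset.disjoint_iff_inter_eq_empty]
    rcases h _ (flagTop_mem ht f) _ (flagTop_mem ht g) with h | h
    · exact h
    -- A union of size `n` leaves at most `2 * t - n = 0` for the intersection.
    · have := Finset.card_union_add_card_inter (flagTop ht f : Finset (Fin n)) (flagTop ht g)
      rw [h, card_flagTop, card_flagTop, Finset.card_univ, Fintype.card_fin] at this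
      exact Finset.card_eq_zero.1 (by omega)
  · intro h A hA B hB
    exact Or.inl (Finset.disjoint_iff_inter_eq_empty.1
      (h.mono (subset_flagTop ht f hA) (subset_flagTop ht g hB)))

lemma generalPositionGraph_adj (hT : T ⊆ Finset.Ioo 0 n) (ht : IsGreatest (T : Set ℕ) t)
    (htn : 2 * t ≤ n) (f g : FlagOfType n T) : (generalPositionGraph n T).Adj f g ↔
      (kneserGraph n t).Adj (flagTop ht f) (flagTop ht g) := by
  have ht0 : 0 < t := (Finset.mem_Ioo.1 (hT ht.1)).1
  rw [kneserGraph_adj ht0, ← inGeneralPosition_iff ht htn]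
  refine ⟨fun h => h.2, fun h => ⟨?_, h⟩⟩
  rintro rfl
  rw [inGeneralPosition_iff ht htn, disjoint_self, Finset.bot_eq_empty] at h
  have := card_flagTop ht f
  rw [h, Finset.card_empty] at this
  omega

/-- The image of a flag under a permutation. -/
def permFlag (σ : Equiv.Perm (Fin n)) (f : FlagOfType n T) : FlagOfType n T :=
  ⟨σ • f.1, by
    refine ⟨⟨fun A hA => ?_, fun A hA B hB => ?_⟩, ?_⟩
    · obtain ⟨A, hA', rfl⟩ := Finset.mem_smul_finset.1 hA
      refine ⟨(f.2.1.1 A hA').1.smul_finset, fun h => (f.2.1.1 A hA').2 ?_⟩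
      rw [← Finset.card_eq_iff_eq_univ] at h ⊢
      rwa [Finset.card_smul_finset] at h
    · obtain ⟨A, hA', rfl⟩ := Finset.mem_smul_finset.1 hA
      obtain ⟨B, hB', rfl⟩ := Finset.mem_smul_finset.1 hB
      simpa using f.2.1.2 A hA' B hB'
    · refine Eq.trans ?_ f.2.2
      ext k
      simp [flagType, Finset.mem_smul_finset]⟩

lemma permFlag_injective (σ : Equiv.Perm (Fin n)) :
    Function.Injective (permFlag σ : FlagOfType n T → FlagOfType n T) := fun _ _ h =>
  Subtype.ext (smul_left_cancel σ (congrArg Subtype.val h))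

lemma smul_mem_permFlag (σ : Equiv.Perm (Fin n)) {f : FlagOfType n T} {A : Finset (Fin n)}
    (hA : A ∈ f.1) : σ • A ∈ (permFlag σ f).1 :=
  Finset.smul_mem_smul_finset hA

/-- The flag formed by the initial segments of the prescribed sizes. -/
def initialFlag (hT : T ⊆ Finset.Ioo 0 n) : FlagOfType n T :=
  ⟨T.image fun k => Finset.univ.filter fun i : Fin n => i.1 < k, by
    have hcard : ∀ k ∈ T, (Finset.univ.filter fun i : Fin n => i.1 < k).card = k := by
      intro k hk
      have := Finset.mem_Ioo.1 (hT hk)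
      rw [Fin.card_filter_val_lt]
      omega
    refine ⟨⟨fun A hA => ?_, fun A hA B hB => ?_⟩, ?_⟩
    · obtain ⟨k, hk, rfl⟩ := Finset.mem_image.1 hA
      have hk' := Finset.mem_Ioo.1 (hT hk)
      refine ⟨Finset.card_pos.1 (by rw [hcard k hk]; exact hk'.1), fun h => ?_⟩
      have := hcard k hk
      rw [h, Finset.card_univ, Fintype.card_fin] at this
      omega
    · obtain ⟨k, hk, rfl⟩ := Finset.mem_image.1 hA
      obtain ⟨l, hl, rfl⟩ := Finset.mem_image.1 hB
      have mono : ∀ {k l : ℕ}, k ≤ l → (Finset.univ.filter fun i : Fin n => i.1 < k) ⊆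
          Finset.univ.filter fun i : Fin n => i.1 < l := fun hkl i hi => by
        simp only [Finset.mem_filter, Finset.mem_univ, true_and] at hi ⊢
        omega
      exact (le_total k l).imp mono mono
    · rw [flagType, Finset.image_image]
      exact (Finset.image_congr fun k hk => hcard k hk).trans Finset.image_id⟩

lemma exists_perm_smul_finset_eq {A B : Finset (Fin n)} (h : A.card = B.card) :
    ∃ σ : Equiv.Perm (Fin n), σ • A = B := by
  obtain ⟨σ, hσ⟩ := (Set.powersetCard.isPretransitive (α := Fin n) (n := B.card)).exists_smul_eq
    ⟨A, Set.powersetCard.mem_iff.2 h⟩ ⟨B, Set.powersetCard.mem_iff.2 rfl⟩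
  exact ⟨σ, by simpa only [Set.powersetCard.coe_smul] using congrArg Subtype.val hσ⟩

/-- There is a flag through any set of a prescribed size. -/
lemma nonempty_flagsThrough (hT : T ⊆ Finset.Ioo 0 n) {A : Finset (Fin n)} (hA : A.card ∈ T) :
    (flagsThrough T A).Nonempty := by
  obtain ⟨B, hB, hcard⟩ := (initialFlag hT).exists_mem_card hA
  obtain ⟨σ, hσ⟩ := exists_perm_smul_finset_eq hcard
  refine ⟨permFlag σ (initialFlag hT), ?_⟩
  rw [← hσ]
  exact smul_mem_permFlag σ hB

/-- A permutation carrying `A` to `B` injects one set of flags into the other. This makes `m` well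
defined. -/
lemma ncard_flagsThrough_eq {A B : Finset (Fin n)} (h : A.card = B.card) :
    (flagsThrough T A).ncard = (flagsThrough T B).ncard := by
  have key : ∀ {A B : Finset (Fin n)}, A.card = B.card →
      (flagsThrough T A).ncard ≤ (flagsThrough T B).ncard := by
    intro A B h
    obtain ⟨σ, hσ⟩ := exists_perm_smul_finset_eq h
    refine Set.ncard_le_ncard_of_injOn (permFlag σ) (fun f hf => ?_)
      ((permFlag_injective σ).injOn) (Set.toFinite _)
    rw [← hσ]
    exact smul_mem_permFlag σ hf
  exact (key h).antisymm (key h.symm)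

/-- If there are at least two sizes, then the flags through a set of the largest size form a
nontrivial block. -/
lemma not_isTrivialBlock_flagsThrough (hT : T ⊆ Finset.Ioo 0 n) (ht : IsGreatest (T : Set ℕ) t)
    (hcard : 2 ≤ T.card) {A : Finset (Fin n)} (hA : A.card = t) :
    ¬ MulAction.IsTrivialBlock (flagsThrough T A) := by
  have htn := Finset.mem_Ioo.1 (hT ht.1)
  obtain ⟨f, hf⟩ := nonempty_flagsThrough hT (hA.symm ▸ ht.1 : A.card ∈ T)
  have hfA : A ∈ f.1 := hf
  obtain ⟨x₀, hx₀⟩ := Finset.card_pos.1 (show 0 < A.card by omega)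
  rintro (hsub | huniv)
  -- Swapping a point of a smaller member `B` with a point of `A \ B` fixes `A` but moves `B`,
  -- giving a second flag through `A`.
  · obtain ⟨s, hs, hst⟩ := Finset.exists_mem_ne (show 1 < T.card by omega) t
    have hslt : s < t := lt_of_le_of_ne (ht.2 hs) hst
    obtain ⟨B, hB, hBs⟩ := f.exists_mem_card hs
    obtain ⟨x, hx⟩ := (f.2.1.1 B hB).1
    have hBA : B ⊆ A := by
      rcases f.2.1.2 B hB A hfA with h | h
      · exact h
      · have := Finset.card_le_card h
        omega
    obtain ⟨y, hy, hyB⟩ := Finset.exists_mem_notMem_of_card_lt_card (show B.card < A.card by omega)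
    have hswap : Equiv.swap x y • A = A := by
      refine Finset.eq_of_subset_of_card_le (fun z hz => ?_) (Finset.card_smul_finset _ _).ge
      obtain ⟨w, hw, rfl⟩ := Finset.mem_smul_finset.1 hz
      rw [Equiv.Perm.smul_def, Equiv.swap_apply_def]
      split_ifs
      · exact hy
      · exact hBA hx
      · exact hw
    have hmem : permFlag (Equiv.swap x y) f ∈ flagsThrough T A := by
      have := smul_mem_permFlag (Equiv.swap x y) hfA
      rwa [hswap] at this
    have heq := hsub hmem hf
    have hB' := smul_mem_permFlag (Equiv.swap x y) hB
    rw [heq] at hB'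
    have := f.eq_of_card_eq hB' hB (Finset.card_smul_finset _ _)
    apply hyB
    rw [← this]
    exact Finset.mem_smul_finset.2 ⟨x, hx, Equiv.swap_apply_left x y⟩
  -- A transposition moves `A` to another `t`-set; a flag through that set cannot contain `A`.
  · obtain ⟨y, hy⟩ : ∃ y, y ∉ A := by
      by_contra! h
      rw [Finset.eq_univ_iff_forall.2 h, Finset.card_univ, Fintype.card_fin] at hA
      omega
    obtain ⟨g, hg⟩ := nonempty_flagsThrough hT (A := Equiv.swap x₀ y • A) (by
      rw [Finset.card_smul_finset, hA]
      exact ht.1)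
    have hgA : A ∈ g.1 := by
      change g ∈ flagsThrough T A
      rw [huniv]
      trivial
    have := g.eq_of_card_eq hg hgA (Finset.card_smul_finset _ _)
    apply hy
    rw [← this]
    exact Finset.mem_smul_finset.2 ⟨x₀, hx₀, Equiv.swap_apply_left x₀ y⟩

end Flags

/-! ### Assembly of the theorem. -/

theorem lemma4p2 (n : ℕ) (T : Finset ℕ) (hT : T ⊆ Finset.Ioo 0 n)
    (t : ℕ) (ht : IsGreatest (T : Set ℕ) t) (htn : 2 * t ≤ n) :
    IsSystemOfBlocks (GraphAut (generalPositionGraph n T))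
        {D : Set (FlagOfType n T) | ∃ A : Finset (Fin n), A.card = t ∧ D = flagsThrough T A} ∧
    (2 ≤ T.card → ∀ A : Finset (Fin n), A.card = t →
      ¬ MulAction.IsTrivialBlock (flagsThrough T A)) ∧
    (∀ A : Finset (Fin n), A.card = t →
      Nonempty (GraphAut (generalPositionGraph n T) ≃*
        PermWreath (flagsThrough T A).ncard (Set.powersetCard (Fin n) t)
          (GraphAut (kneserGraph n t)))) ∧
    (2 * t < n ∨ n = 2 → ∀ A : Finset (Fin n), A.card = t →
      Nonempty (GraphAut (generalPositionGraph n T) ≃*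
        PermWreath (flagsThrough T A).ncard (Set.powersetCard (Fin n) t)
          (Equiv.Perm (Fin n)))) := by
  have htmem := Finset.mem_Ioo.1 (hT ht.1)
  have hadj := generalPositionGraph_adj hT ht htn
  have hK := kneserGraph_twinFree htmem.1 htn
  have hcoe : ∀ A : Set.powersetCard (Fin n) t, (A : Finset (Fin n)).card = t := fun A => A.2
  have hsurj : Function.Surjective (flagTop ht : FlagOfType n T → _) := fun A => by
    obtain ⟨f, hf⟩ := nonempty_flagsThrough hT (A := (A : Finset (Fin n)))
      (by rw [hcoe A]; exact ht.1)
    exact ⟨f, (flagTop_eq_iff ht f A).2 hf⟩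
  have hfibre : ∀ A : Finset (Fin n), A.card = t →
      ∃ e : FlagOfType n T ≃ Set.powersetCard (Fin n) t × Fin (flagsThrough T A).ncard,
        ∀ f, (e f).1 = flagTop ht f := fun A hA =>
    exists_equiv_prod_of_ncard_fibre fun B => by
      rw [preimage_flagTop]
      exact ncard_flagsThrough_eq ((hcoe B).trans hA.symm)
  have hm : ∀ A : Finset (Fin n), A.card = t → NeZero (flagsThrough T A).ncard := fun A hA =>
    ⟨Set.ncard_ne_zero_of_mem (nonempty_flagsThrough hT (hA.symm ▸ ht.1 : A.card ∈ T)).some_mem⟩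
  have hadj' : ∀ A (hA : A.card = t), ∀ f g, (generalPositionGraph n T).Adj f g ↔
      (kneserGraph n t).Adj ((hfibre A hA).choose f).1 ((hfibre A hA).choose g).1 :=
    fun A hA f g => by
      rw [(hfibre A hA).choose_spec, (hfibre A hA).choose_spec]
      exact hadj f g
  refine ⟨?_, fun h2 A hA => not_isTrivialBlock_flagsThrough hT ht h2 hA, fun A hA => ?_,
    fun h A hA => ?_⟩
  · have : Nonempty (FlagOfType n T) := ⟨initialFlag hT⟩
    have hA : (flagTop ht (initialFlag hT) : Finset (Fin n)).card = t := card_flagTop ht _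
    have := Set.powersetCard.isPretransitive (α := Fin n) (n := t)
    have := isPretransitive_blowUp (G := Equiv.Perm (Fin n)) _ (hadj' _ hA)
      (kneserGraph_adj_smul htmem.1)
    convert isSystemOfBlocks_fibres hsurj hadj hK using 1
    ext D
    constructor
    · rintro ⟨A, hA, rfl⟩
      exact ⟨_, (preimage_flagTop ht ⟨A, Set.powersetCard.mem_iff.2 hA⟩).symm⟩
    · rintro ⟨A, rfl⟩
      exact ⟨A, hcoe A, preimage_flagTop ht A⟩
  · have := hm A hA
    exact nonempty_mulEquiv_permWreath _ (hadj' A hA) hK (fun φ a b => φ.map_adj_iff)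
      fun φ => ⟨φ, fun _ => rfl⟩
  · have := hm A hA
    have : FaithfulSMul (Equiv.Perm (Fin n)) (Set.powersetCard (Fin n) t) :=
      Set.powersetCard.faithfulSMul htmem.1 (by simpa using htmem.2)
    exact nonempty_mulEquiv_permWreath _ (hadj' A hA) hK (kneserGraph_adj_smul htmem.1)
      -- The case `n = 2` forces `t = 1`.
      (exists_perm_of_kneserGraph_aut htmem.1 (by omega))
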